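/- Let $r\ge 1$ receive antennas and $K$ users be given. The channel vectors $\mathbf h_1,\dots,\mathbf h_K\in\mathbb C^r$ are independent, and the real and imaginary parts of their entries are independent $N(0,1/2)$ variables; every transmitting user has power $P>0$ and the noise has unit variance. For a set $S$ of transmitting users and $i\in S$, let $\mathbf V_i$ be a matrix whose rows form an orthonormal basis of the null space of the channels $\{\mathbf h_l\}_{l\in S\setminus\{i\}}$, so that $\|\mathbf V_i\mathbf h_i\|$ is the norm of the orthogonal projection of $\mathbf h_i$ onto the orthogonal complement of $\operatorname{span}\{\mathbf h_l : l\in S\setminus\{i\}\}$. The zero-forcing (ZF) sum rate of $S$ is $$R_P(S)=\sum_{i\in S}\log\bigl(1+P\|\mathbf V_i\mathbf h_i\|^2\bigr).$$ In the algorithm Channel-Access with threshold $u$, user $i$ transmits if and only if $\|\mathbf h_i\|^2>u$. Let $S_u=\{i:\|\mathbf h_i\|^2>u\}$. A slot in which more than $r$ users transmit is lost, so the expected sum capacity is $\mathrm E\,C(u)=\mathrm E\bigl[R_P(S_u)\,\mathbf 1\{|S_u|\le r\}\bigr]$. For $k>0$, $u_k$ denotes a threshold that $k$ users exceed on average, i.e.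 $\mathrm E|S_{u_k}|=k$. The expected sum capacity of the algorithm is the optimum over $k$, $C^*=\sup_{0<k\le r}\mathrm E\,C(u_k)$. The centralized ZF capacity is $C_{\mathrm{cen}}=\mathrm E\bigl[\max_{|I|=r}R_P(I)\bigr]$, where $I$ ranges over the sets of $r$ users. **Theorem.** With ZF decoding, the expected sum capacity of the single-threshold distributed algorithm Channel-Access scales as $\Theta(r\log(P\log K))$ for a large number of users $K$, and this matches the centralized scaling law. Precisely: there are absolute constants $0<c\le C$ such that for every $r\ge 1$ there is an $M=M(r)$ such that, for all $K\ge M$ and all $P>0$ with $P\log K\ge M$, $$c\,r\log(P\log K)\;\le\; C^*\;\le\; C\,r\log(P\log K),$$ a threshold $u_r$ that $r$ users exceed on average exists, and the same two bounds hold for $\mathrm E\,C(u_r)$ (that is, already for $k=r$) and for $C_{\mathrm{cen}}$. In particular, for fixed $r$ and $P$ all three quantities are $\Theta(r\log(P\log K))$ as $K\to\infty$, with constants that depend neither on $r$ nor on $P$. -/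

import Mathlib

open MeasureTheory ProbabilityTheory
open scoped ENNReal

namespace ZFAccess

/-- A channel vector in `ℂ^r`, with the Euclidean norm. -/
abbrev ChannelVec (r : ℕ) : Type := EuclideanSpace ℂ (Fin r)

/-- Assemble a channel vector from the real and imaginary parts of its entries. -/
noncomputable def assemble (r : ℕ) (x : Fin r → ℝ × ℝ) : ChannelVec r :=
  WithLp.toLp 2 (fun n => (⟨(x n).1, (x n).2⟩ : ℂ))

/-- The law of one channel vector: the real and imaginary parts of the `r` entries are
independent centred Gaussians of variance `1/2`. -/
noncomputable def channelLaw (r : ℕ) : Measure (ChannelVec r) :=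
  (Measure.pi (fun _ : Fin r => (gaussianReal 0 (1 / 2)).prod (gaussianReal 0 (1 / 2)))).map
    (assemble r)

/-- The joint law of the `K` channel vectors in one slot: the users are i.i.d. -/
noncomputable def usersLaw (r K : ℕ) : Measure (Fin K → ChannelVec r) :=
  Measure.pi (fun _ : Fin K => channelLaw r)

theorem measurable_assemble (r : ℕ) : Measurable (assemble r) := by
  have h : Continuous (assemble r) := by
    unfold assemble
    refine (PiLp.continuous_toLp 2 _).comp (continuous_pi fun n => ?_)
    have e : (fun x : Fin r → ℝ × ℝ => (⟨(x n).1, (x n).2⟩ : ℂ))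
        = fun x => (((x n).1 : ℂ) + ((x n).2 : ℂ) * Complex.I) := by
      funext x
      exact Complex.mk_eq_add_mul_I _ _
    rw [e]
    fun_prop
  exact h.measurable

instance (r : ℕ) : IsProbabilityMeasure (channelLaw r) :=
  Measure.isProbabilityMeasure_map (measurable_assemble r).aemeasurable

instance (r K : ℕ) : IsProbabilityMeasure (usersLaw r K) := by
  unfold usersLaw
  infer_instance

/-- The users that transmit when the threshold on the squared norm is `u`. -/
noncomputable def transmitters {r K : ℕ} (h : Fin K → ChannelVec r) (u : ℝ) : Finset (Fin K) :=
  Finset.univ.filter (fun i => u < ‖h i‖ ^ 2)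

/-- The zero-forcing gain `‖V_i h_i‖²` of user `i` when the users in `S` transmit. The rows of
`V_i` are an orthonormal basis of the null space of the other transmitting users' channels, so
this is the squared norm of the orthogonal projection of `h_i` onto the orthogonal complement
of the span of those channels. -/
noncomputable def zfGain {r K : ℕ} (h : Fin K → ChannelVec r) (S : Finset (Fin K)) (i : Fin K) :
    ℝ :=
  ‖(Submodule.span ℂ (h '' {l | l ∈ S ∧ l ≠ i}))ᗮ.starProjection (h i)‖ ^ 2

/-- The sum rate under zero-forcing decoding when exactly the users in `S` transmit, each with
power `P` (unit noise variance). -/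
noncomputable def zfSumRate {r K : ℕ} (P : ℝ) (h : Fin K → ChannelVec r) (S : Finset (Fin K)) :
    ℝ :=
  ∑ i ∈ S, Real.log (1 + P * zfGain h S i)

/-- The sum rate of a slot of the single-threshold algorithm: the slot is lost if more than `r`
users transmit, and it contributes `0` if nobody transmits (the sum is then empty). -/
noncomputable def slotRate {r K : ℕ} (P u : ℝ) (h : Fin K → ChannelVec r) : ℝ :=
  if (transmitters h u).card ≤ r then zfSumRate P h (transmitters h u) else 0

/-- The expected sum capacity of the single-threshold algorithm with threshold `u`. The
integrand is non-negative for `P ≥ 0`; the expectation is taken in `[0, ∞]`. -/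
noncomputable def expectedCapacity (r K : ℕ) (P u : ℝ) : ℝ≥0∞ :=
  ∫⁻ h, ENNReal.ofReal (slotRate P u h) ∂(usersLaw r K)

/-- `u` is a threshold that `k` of the `K` users exceed on average. -/
def IsThreshold (r K : ℕ) (k u : ℝ) : Prop :=
  ∫⁻ h, ((transmitters h u).card : ℝ≥0∞) ∂(usersLaw r K) = ENNReal.ofReal k

/-- The expected sum capacity of the single-threshold algorithm, optimized over the average
number `k ∈ (0, r]` of users that exceed the threshold. -/
noncomputable def optimalExpectedCapacity (r K : ℕ) (P : ℝ) : ℝ≥0∞ :=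
  ⨆ (k : ℝ) (_ : k ∈ Set.Ioc (0 : ℝ) r) (u : ℝ) (_ : IsThreshold r K k u),
    expectedCapacity r K P u

/-- The expected sum capacity of centralized scheduling with zero-forcing decoding: in each slot
the base station sees all channels and schedules the best group of `r` users. -/
noncomputable def centralizedCapacity (r K : ℕ) (P : ℝ) : ℝ≥0∞ :=
  ∫⁻ h, (⨆ (S : Finset (Fin K)) (_ : S.card = r), ENNReal.ofReal (zfSumRate P h S))
    ∂(usersLaw r K)

end ZFAccess

namespace ZFAccess

/-! Write `L = log K`, `p` for the probability that a given user exceeds the threshold, and `N` for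
the number of transmitters.

Upper bound (`exists_dominating_rate`): a zero-forcing gain never exceeds the squared norm of the
channel, and the largest of `K` squared norms has mean of order at most `L`, because the squared
norm has an exponential moment. Hence one integrable function dominates the rates of all groups of
at most `r` users at once, and its mean is at most `3 r log (P L)`. This covers every threshold as
well as centralized scheduling.

Lower bound (`exists_le_lintegral_sum_log_zfGain`): take a threshold with `K p = r` and replace the
channel of user `i` by an independent copy `y`, which preserves the joint law. If fewer than `r`
users transmitted before and `y` exceeds the threshold, then at most `r` transmit now, and the other
channels of the group span at most `r - 1` dimensions. A unit vector `v` orthogonal to them is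
available before `y` is drawn. By unitary invariance the direction of `y` is independent of its
norm, so the gain is at least `|⟨v, y⟩|² ≥ ε u` with conditional probability at least `1/2`
(`exists_half_le_channelLaw_inner`). Summing over `i` gives the factor `K p / 2 = r / 2`. Two facts
finish: `N < r` has probability at least `1/1200` (`binomial_lt_mean`), and `u ≥ L / 4`
(`exists_log_le_threshold`).

The quantities `ε` and the exponential moment depend on `r`, but they enter only inside a logarithm
or as an additive term. Taking `P L` large in terms of `r` absorbs them, so the final constants are
absolute. -/

/-! ### Resampling one coordinate of a product law -/

theorem measurable_update_prod {ι : Type*} [DecidableEq ι] {X : Type*}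
    [MeasurableSpace X] (i : ι) :
    Measurable fun q : (ι → X) × X => Function.update q.1 i q.2 := by
  refine measurable_pi_lambda _ fun j => ?_
  by_cases hj : j = i
  · subst hj; simpa using measurable_snd
  · simp only [Function.update_of_ne hj]
    fun_prop

/-- Replacing one coordinate of a product law by a fresh copy does not change the law. -/
theorem map_update_pi_prod {ι : Type*} [Fintype ι] [DecidableEq ι] {X : Type*}
    [MeasurableSpace X] (ν : Measure X) [IsProbabilityMeasure ν] (i : ι) :
    ((Measure.pi fun _ : ι => ν).prod ν).map (fun q => Function.update q.1 i q.2)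
      = Measure.pi fun _ : ι => ν := by
  have hm := measurable_update_prod (X := X) i
  refine (Measure.pi_eq fun s hs => ?_).symm
  rw [Measure.map_apply hm (MeasurableSet.univ_pi hs)]
  have e : (fun q : (ι → X) × X => Function.update q.1 i q.2) ⁻¹' Set.univ.pi s
      = (Set.univ.pi (Function.update s i Set.univ)) ×ˢ s i := by
    ext ⟨f, x⟩
    simp only [Set.mem_preimage, Set.mem_univ_pi, Set.mem_prod]
    constructor
    · intro h
      refine ⟨fun j => ?_, by simpa using h i⟩
      by_cases hj : j = i
      · subst hj; simp
      · simpa [Function.update_of_ne hj] using h j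
    · rintro ⟨h, hx⟩ j
      by_cases hj : j = i
      · subst hj; simpa using hx
      · simpa [Function.update_of_ne hj] using h j
  rw [e, Measure.prod_prod, Measure.pi_pi, ← Finset.mul_prod_erase _ _ (Finset.mem_univ i),
    ← Finset.mul_prod_erase _ (fun j => ν (s j)) (Finset.mem_univ i)]
  simp only [Function.update_self, measure_univ, one_mul]
  rw [mul_comm]
  congr 1
  refine Finset.prod_congr rfl fun j hj => ?_
  rw [Function.update_of_ne (Finset.ne_of_mem_erase hj)]

theorem lintegral_pi_eq_lintegral_update {ι : Type*} [Fintype ι] [DecidableEq ι] {X : Type*}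
    [MeasurableSpace X] (ν : Measure X) [IsProbabilityMeasure ν] (i : ι) {f : (ι → X) → ℝ≥0∞}
    (hf : Measurable f) :
    ∫⁻ x, f x ∂(Measure.pi fun _ : ι => ν)
      = ∫⁻ x, ∫⁻ y, f (Function.update x i y) ∂ν ∂(Measure.pi fun _ : ι => ν) := by
  conv_lhs => rw [← map_update_pi_prod ν i]
  rw [lintegral_map hf (measurable_update_prod i), lintegral_prod]
  exact (hf.comp (measurable_update_prod i)).aemeasurable

theorem measure_pi_eq_lintegral_update {ι : Type*} [Fintype ι] [DecidableEq ι] {X : Type*}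
    [MeasurableSpace X] (ν : Measure X) [IsProbabilityMeasure ν] (i : ι) {s : Set (ι → X)}
    (hs : MeasurableSet s) :
    (Measure.pi fun _ : ι => ν) s
      = ∫⁻ x, ν {y | Function.update x i y ∈ s} ∂(Measure.pi fun _ : ι => ν) := by
  rw [← lintegral_indicator_one hs, lintegral_pi_eq_lintegral_update ν i
    (measurable_one.indicator hs)]
  refine lintegral_congr fun x => ?_
  have : MeasurableSet {y | Function.update x i y ∈ s} :=
    (measurable_update_prod i).comp measurable_prodMk_left hs
  rw [← lintegral_indicator_one this]
  rfl

/-! ### Characteristic function, Gaussianity and unitary invariance of the channel law -/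

/-- The law of one entry of a channel vector. -/
noncomputable def entryLaw : Measure ℂ :=
  ((gaussianReal 0 (1 / 2)).prod (gaussianReal 0 (1 / 2))).map fun x => (⟨x.1, x.2⟩ : ℂ)

theorem measurable_complex_mk : Measurable fun x : ℝ × ℝ => (⟨x.1, x.2⟩ : ℂ) :=
  Complex.measurableEquivRealProd.symm.measurable

instance : IsProbabilityMeasure entryLaw :=
  Measure.isProbabilityMeasure_map measurable_complex_mk.aemeasurable

theorem channelLaw_eq_map_pi (r : ℕ) :
    channelLaw r = (Measure.pi fun _ : Fin r => entryLaw).map (WithLp.toLp 2) := by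
  have h : (Measure.pi fun _ : Fin r => entryLaw)
      = (Measure.pi (fun _ : Fin r => (gaussianReal 0 (1 / 2)).prod (gaussianReal 0 (1 / 2)))).map
        (fun x n => (⟨(x n).1, (x n).2⟩ : ℂ)) := by
    unfold entryLaw
    have : IsProbabilityMeasure (((gaussianReal 0 (1 / 2)).prod (gaussianReal 0 (1 / 2))).map
        fun x : ℝ × ℝ => (⟨x.1, x.2⟩ : ℂ)) :=
      Measure.isProbabilityMeasure_map measurable_complex_mk.aemeasurable
    exact (Measure.pi_map_pi
      (μ := fun _ : Fin r => (gaussianReal 0 (1 / 2)).prod (gaussianReal 0 (1 / 2)))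
      (f := fun _ x => (⟨x.1, x.2⟩ : ℂ))
      (fun _ => measurable_complex_mk.aemeasurable)).symm
  rw [h, Measure.map_map]
  · rfl
  · fun_prop
  · exact measurable_pi_lambda _ fun n => measurable_complex_mk.comp (measurable_pi_apply n)

theorem charFun_entryLaw (t : ℂ) : charFun entryLaw t = Complex.exp (-‖t‖ ^ 2 / 4) := by
  rw [charFun_apply, entryLaw, integral_map measurable_complex_mk.aemeasurable (by fun_prop)]
  have e : ∀ x : ℝ × ℝ, Complex.exp ((inner ℝ (⟨x.1, x.2⟩ : ℂ) t : ℝ) * Complex.I)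
      = Complex.exp (t.re * x.1 * Complex.I) * Complex.exp (t.im * x.2 * Complex.I) := by
    intro x
    rw [← Complex.exp_add]
    congr 1
    simp [Complex.inner]
    ring
  simp_rw [e]
  rw [integral_prod_mul (fun a : ℝ => Complex.exp (t.re * a * Complex.I))
    (fun a : ℝ => Complex.exp (t.im * a * Complex.I)), ← charFun_apply_real, ← charFun_apply_real,
    charFun_gaussianReal, charFun_gaussianReal, ← Complex.exp_add]
  congr 1
  have h : ((‖t‖ : ℂ)) ^ 2 = (t.re : ℂ) ^ 2 + (t.im : ℂ) ^ 2 := by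
    rw [← Complex.ofReal_pow, Complex.sq_norm, Complex.normSq_apply]; push_cast; ring
  rw [h]
  push_cast
  ring

theorem charFun_channelLaw (r : ℕ) (t : ChannelVec r) :
    charFun (channelLaw r) t = Complex.exp (-‖t‖ ^ 2 / 4) := by
  rw [channelLaw_eq_map_pi, charFun_pi]
  simp_rw [charFun_entryLaw]
  rw [← Complex.exp_sum, ← Complex.ofReal_pow, EuclideanSpace.norm_sq_eq]
  push_cast
  rw [← Finset.sum_neg_distrib, Finset.sum_div]

/-- Serves to make the law an instance of `IsGaussian`, from which the exponential moment of the
squared norm follows. -/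
theorem channelLaw_eq_map_stdGaussian (r : ℕ) :
    channelLaw r = (stdGaussian (ChannelVec r)).map
      ((Real.sqrt 2)⁻¹ • ContinuousLinearMap.id ℝ (ChannelVec r)) := by
  have : IsProbabilityMeasure ((stdGaussian (ChannelVec r)).map
      ((Real.sqrt 2)⁻¹ • ContinuousLinearMap.id ℝ (ChannelVec r))) :=
    Measure.isProbabilityMeasure_map (by fun_prop)
  refine Measure.ext_of_charFun (funext fun t => ?_)
  have e := charFun_map_smul (μ := stdGaussian (ChannelVec r)) (Real.sqrt 2)⁻¹ t
  rw [charFun_channelLaw]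
  refine Eq.trans ?_ e.symm
  rw [charFun_stdGaussian, norm_smul]
  congr 1
  push_cast
  rw [mul_pow, norm_inv, Real.norm_of_nonneg (Real.sqrt_nonneg 2)]
  have : (((Real.sqrt 2)⁻¹ : ℝ) : ℂ) ^ 2 = 1 / 2 := by
    rw [← Complex.ofReal_pow, inv_pow, Real.sq_sqrt (by norm_num)]; simp
  rw [this]
  ring

instance isGaussian_channelLaw (r : ℕ) : IsGaussian (channelLaw r) := by
  rw [channelLaw_eq_map_stdGaussian]
  infer_instance

/-- The law of a channel vector is invariant under unitary maps. -/
theorem channelLaw_map_isometry {r : ℕ} (U : ChannelVec r ≃ₗᵢ[ℂ] ChannelVec r) :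
    (channelLaw r).map U = channelLaw r := by
  -- `charFun` is built on the real inner product, so `U` is also viewed as a real isometry.
  let V : ChannelVec r ≃ₗᵢ[ℝ] ChannelVec r :=
    { U.toLinearEquiv.restrictScalars ℝ with norm_map' := U.norm_map }
  have hV : ∀ x, V x = U x := fun _ => rfl
  have : IsProbabilityMeasure ((channelLaw r).map U) :=
    Measure.isProbabilityMeasure_map U.continuous.measurable.aemeasurable
  refine Measure.ext_of_charFun (funext fun t => ?_)
  have h : charFun ((channelLaw r).map U) t = charFun (channelLaw r) (V.symm t) := by
    rw [charFun_apply, integral_map U.continuous.measurable.aemeasurable (by fun_prop),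
      charFun_apply]
    refine integral_congr_ae (.of_forall fun x => ?_)
    simp only [← hV]
    rw [← V.inner_map_map x (V.symm t), V.apply_symm_apply]
  rw [h, charFun_channelLaw, charFun_channelLaw, V.symm.norm_map]

/-! ### Marginals, null sets, tails and exponential moments -/

theorem channelLaw_map_apply (r : ℕ) (n : Fin r) :
    (channelLaw r).map (fun x => x n) = entryLaw := by
  rw [channelLaw_eq_map_pi, Measure.map_map (by fun_prop) (by fun_prop)]
  exact (measurePreserving_eval (fun _ : Fin r => entryLaw) n).map_eq

theorem entryLaw_map_re : entryLaw.map Complex.re = gaussianReal 0 (1 / 2) := by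
  rw [entryLaw, Measure.map_map Complex.measurable_re measurable_complex_mk]
  exact Measure.map_fst_prod.trans (by simp)

theorem half_ne_zero_nnreal : (1 / 2 : NNReal) ≠ 0 := by norm_num

instance : NullSingletonClass (gaussianReal 0 (1 / 2)) :=
  nullSingletonClass_gaussianReal half_ne_zero_nnreal

/-- A set of complex numbers whose real parts take finitely many values is a null set for the law
of one entry. -/
theorem entryLaw_null_of_re_mem {s : Set ℂ} (t : Set ℝ) (ht : t.Finite)
    (h : ∀ z ∈ s, z.re ∈ t) : entryLaw s = 0 := by
  refine measure_mono_null (t := Complex.re ⁻¹' t) h ?_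
  rw [← Measure.map_apply Complex.measurable_re ht.measurableSet, entryLaw_map_re]
  exact ht.measure_zero _

/-- Once the real part is fixed, at most two imaginary parts remain. -/
theorem entryLaw_sphere (v : ℝ) : entryLaw {z | ‖z‖ ^ 2 = v} = 0 := by
  have hs : MeasurableSet {z : ℂ | ‖z‖ ^ 2 = v} :=
    measurableSet_eq_fun (by fun_prop) measurable_const
  rw [entryLaw, Measure.map_apply measurable_complex_mk hs,
    Measure.measure_prod_null (measurable_complex_mk hs)]
  refine .of_forall fun a => ?_
  refine Set.Finite.measure_zero (Set.Finite.subset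
    (Set.toFinite {Real.sqrt (v - a ^ 2), -Real.sqrt (v - a ^ 2)}) fun b hb => ?_) _
  have h : a ^ 2 + b ^ 2 = v := by
    have := hb
    simp only [Set.mem_preimage, Set.mem_ofPred_eq, Complex.sq_norm, Complex.normSq_mk] at this
    linarith
  have h2 : b ^ 2 = Real.sqrt (v - a ^ 2) ^ 2 := by
    rw [Real.sq_sqrt (by nlinarith [sq_nonneg b])]; linarith
  simpa using sq_eq_sq_iff_eq_or_eq_neg.mp h2

/-- Resampling one entry reduces this to a circle in `ℂ`. It makes the distribution function of the
squared norm continuous, hence thresholds exist. -/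
theorem channelLaw_sphere {r : ℕ} (hr : 1 ≤ r) (u : ℝ) :
    channelLaw r {x | ‖x‖ ^ 2 = u} = 0 := by
  have hs : MeasurableSet {x : ChannelVec r | ‖x‖ ^ 2 = u} :=
    measurableSet_eq_fun (by fun_prop) measurable_const
  have hp : Measurable (WithLp.toLp 2 : (Fin r → ℂ) → ChannelVec r) := by fun_prop
  rw [channelLaw_eq_map_pi, Measure.map_apply hp hs,
    measure_pi_eq_lintegral_update entryLaw ⟨0, hr⟩ (hp hs)]
  refine (lintegral_congr fun x => ?_).trans lintegral_zero
  refine measure_mono_null (t := {z | ‖z‖ ^ 2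
    = u - ∑ j ∈ Finset.univ.erase (⟨0, hr⟩ : Fin r), ‖x j‖ ^ 2}) (fun z hz => ?_)
    (entryLaw_sphere _)
  simp only [Set.mem_preimage, Set.mem_ofPred_eq, EuclideanSpace.norm_sq_eq] at hz ⊢
  rw [← Finset.add_sum_erase _ _ (Finset.mem_univ (⟨0, hr⟩ : Fin r)), Function.update_self] at hz
  rw [← hz, add_sub_assoc, eq_comm, add_eq_left, sub_eq_zero]
  refine Finset.sum_congr rfl fun j hj => ?_
  rw [Function.update_of_ne (Finset.ne_of_mem_erase hj)]

theorem channelLaw_apply_eq_zero {r : ℕ} (n : Fin r) : channelLaw r {x | x n = 0} = 0 := by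
  have h : Measurable fun x : ChannelVec r => x n := by fun_prop
  have e : {x : ChannelVec r | x n = 0} = (fun x => x n) ⁻¹' {0} := rfl
  rw [e, ← Measure.map_apply h (measurableSet_singleton 0), channelLaw_map_apply]
  exact entryLaw_null_of_re_mem {0} (Set.finite_singleton 0) (by simp)

/-- The real part of a single entry already suffices. Its density `exp (-x²) / √π` is bounded below
on an interval of length one to the right of `√u`, where `x² ≤ (√u + 1)² ≤ 2 u + 2`; so `b` does not
depend on `r`. -/
theorem exists_exp_le_channelLaw_tail :
    ∃ b : ℝ, 0 < b ∧ ∀ r : ℕ, 1 ≤ r → ∀ u : ℝ, 0 ≤ u →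
      ENNReal.ofReal (b * Real.exp (-(2 * u))) ≤ channelLaw r {x | u < ‖x‖ ^ 2} := by
  refine ⟨(Real.sqrt Real.pi)⁻¹ * Real.exp (-2), by positivity, fun r hr u hu => ?_⟩
  have hu' := Real.sqrt_nonneg u
  calc ENNReal.ofReal ((Real.sqrt Real.pi)⁻¹ * Real.exp (-2) * Real.exp (-(2 * u)))
      = ∫⁻ _ in Set.Ioc (Real.sqrt u) (Real.sqrt u + 1),
          ENNReal.ofReal ((Real.sqrt Real.pi)⁻¹ * Real.exp (-2) * Real.exp (-(2 * u))) := by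
        simp
    _ ≤ ∫⁻ x in Set.Ioc (Real.sqrt u) (Real.sqrt u + 1), gaussianPDF 0 (1 / 2) x := by
        refine setLIntegral_mono (measurable_gaussianPDF _ _) fun x hx => ?_
        refine ENNReal.ofReal_le_ofReal ?_
        rw [gaussianPDFReal, mul_assoc, ← Real.exp_add]
        have h1 : (2 * Real.pi * ((1 / 2 : NNReal) : ℝ)) = Real.pi := by
          push_cast; ring
        rw [h1]
        refine mul_le_mul_of_nonneg_left (Real.exp_le_exp.mpr ?_) (by positivity)
        have h2 : x ^ 2 ≤ (Real.sqrt u + 1) ^ 2 := by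
          have h0 : 0 ≤ x := hu'.trans hx.1.le
          have := hx.2
          gcongr
        have h3 := Real.sq_sqrt hu
        have h4 : -(x - 0) ^ 2 / (2 * ((1 / 2 : NNReal) : ℝ)) = - x ^ 2 := by push_cast; ring
        rw [h4]
        nlinarith [sq_nonneg (Real.sqrt u - 1)]
    _ = gaussianReal 0 (1 / 2) (Set.Ioc (Real.sqrt u) (Real.sqrt u + 1)) :=
        (gaussianReal_apply 0 half_ne_zero_nnreal _).symm
    _ ≤ gaussianReal 0 (1 / 2) (Set.Ioi (Real.sqrt u)) := measure_mono fun x hx => hx.1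
    _ = channelLaw r ((fun x => x (⟨0, hr⟩ : Fin r)) ⁻¹' (Complex.re ⁻¹' Set.Ioi (Real.sqrt u))) := by
        rw [← Measure.map_apply (by fun_prop) (Complex.measurable_re measurableSet_Ioi),
          channelLaw_map_apply, ← Measure.map_apply Complex.measurable_re measurableSet_Ioi,
          entryLaw_map_re]
    _ ≤ channelLaw r {x | u < ‖x‖ ^ 2} := by
        refine measure_mono fun x hx => ?_
        have h1 : Real.sqrt u < (x ⟨0, hr⟩).re := hx
        have h2 : (x ⟨0, hr⟩).re ≤ ‖x‖ :=
          (Complex.re_le_norm _).trans (PiLp.norm_apply_le x ⟨0, hr⟩)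
        have h3 := Real.sq_sqrt hu
        show u < ‖x‖ ^ 2
        nlinarith

/-- The squared norm of a channel vector has an exponential moment. -/
theorem exists_exp_moment_channelLaw (r : ℕ) :
    ∃ a : ℝ, 0 < a ∧ ∫⁻ x, ENNReal.ofReal (Real.exp (a * ‖x‖ ^ 2)) ∂(channelLaw r) < ∞ := by
  obtain ⟨a, ha, h⟩ := IsGaussian.exists_integrable_exp_sq (channelLaw r)
  exact ⟨a, ha, h.lintegral_lt_top⟩

/-! ### Independence of norm and direction -/

/-- Two unit vectors are related by a unitary map. -/
theorem exists_isometry_apply_eq {r : ℕ} {v w : ChannelVec r} (hv : ‖v‖ = 1) (hw : ‖w‖ = 1) :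
    ∃ U : ChannelVec r ≃ₗᵢ[ℂ] ChannelVec r, U v = w := by
  have hr : 0 < r := by
    rcases Nat.eq_zero_or_pos r with rfl | h
    · rw [Subsingleton.elim v 0] at hv; simp at hv
    · exact h
  have key : ∀ x : ChannelVec r, ‖x‖ = 1 →
      ∃ b : OrthonormalBasis (Fin r) ℂ (ChannelVec r), b ⟨0, hr⟩ = x := by
    intro x hx
    obtain ⟨b, hb⟩ := Orthonormal.exists_orthonormalBasis_extension_of_card_eq (𝕜 := ℂ)
      (E := ChannelVec r) (ι := Fin r) (by simp) (v := fun _ => x) (s := {⟨0, hr⟩}) (by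
        constructor
        · intro i; simpa using hx
        · intro i j hij; exact absurd (Subsingleton.elim i j) hij)
    exact ⟨b, hb _ rfl⟩
  obtain ⟨b, hb⟩ := key v hv
  obtain ⟨b', hb'⟩ := key w hw
  refine ⟨b.equiv b' (Equiv.refl _), ?_⟩
  rw [← hb, OrthonormalBasis.equiv_apply_basis, ← hb']
  rfl

/-- `v` and `x` are almost orthogonal: the squared cosine of their angle is below `ε`. -/
def AlmostOrthogonal {r : ℕ} (ε : ℝ) (v x : ChannelVec r) : Prop :=
  ‖inner ℂ v x‖ ^ 2 < ε * (‖v‖ ^ 2 * ‖x‖ ^ 2)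

theorem almostOrthogonal_comm {r : ℕ} {ε : ℝ} {v x : ChannelVec r} :
    AlmostOrthogonal ε v x ↔ AlmostOrthogonal ε x v := by
  unfold AlmostOrthogonal
  rw [norm_inner_symm, mul_comm (‖v‖ ^ 2)]

theorem measurableSet_almostOrthogonal {r : ℕ} (ε : ℝ) :
    MeasurableSet {q : ChannelVec r × ChannelVec r | AlmostOrthogonal ε q.1 q.2} :=
  measurableSet_lt (by fun_prop) (by fun_prop)

theorem measurableSet_norm_sq_gt {r : ℕ} (u : ℝ) :
    MeasurableSet {x : ChannelVec r | u < ‖x‖ ^ 2} :=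
  measurableSet_lt measurable_const (by fun_prop)

theorem exists_isometry_almostOrthogonal_iff {r : ℕ} {v w : ChannelVec r} (hv : v ≠ 0)
    (hw : w ≠ 0) : ∃ U : ChannelVec r ≃ₗᵢ[ℂ] ChannelVec r, ∀ (ε : ℝ) (x : ChannelVec r),
      AlmostOrthogonal ε w (U x) ↔ AlmostOrthogonal ε v x := by
  have hv' : 0 < ‖v‖ := norm_pos_iff.mpr hv
  have hw' : 0 < ‖w‖ := norm_pos_iff.mpr hw
  obtain ⟨U, hU⟩ := exists_isometry_apply_eq (v := ((‖v‖⁻¹ : ℝ) : ℂ) • v)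
    (w := ((‖w‖⁻¹ : ℝ) : ℂ) • w) (by simp [norm_smul, hv'.ne'])
    (by simp [norm_smul, hw'.ne'])
  refine ⟨U, fun ε x => ?_⟩
  have h : w = ((‖w‖ * ‖v‖⁻¹ : ℝ) : ℂ) • U v := by
    have := congrArg (fun y => ((‖w‖ : ℝ) : ℂ) • y) hU
    simp only [map_smul, smul_smul, ← Complex.ofReal_mul, mul_inv_cancel₀ hw'.ne'] at this
    simpa using this.symm
  have ht : 0 < ‖w‖ * ‖v‖⁻¹ := by positivity
  generalize ‖w‖ * ‖v‖⁻¹ = t at h ht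
  unfold AlmostOrthogonal
  rw [h, inner_smul_left, norm_mul, norm_smul, U.inner_map_map, U.norm_map, U.norm_map,
    RCLike.norm_conj, Complex.norm_of_nonneg ht.le, mul_pow, mul_pow]
  have : ε * (t ^ 2 * ‖v‖ ^ 2 * ‖x‖ ^ 2) = t ^ 2 * (ε * (‖v‖ ^ 2 * ‖x‖ ^ 2)) := by ring
  rw [this]
  exact mul_lt_mul_iff_right₀ (by positivity)

theorem channelLaw_almostOrthogonal_congr {r : ℕ} {v w : ChannelVec r} (hv : v ≠ 0) (hw : w ≠ 0)
    (ε u : ℝ) : channelLaw r {x | u < ‖x‖ ^ 2 ∧ AlmostOrthogonal ε v x}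
      = channelLaw r {x | u < ‖x‖ ^ 2 ∧ AlmostOrthogonal ε w x} := by
  obtain ⟨U, hU⟩ := exists_isometry_almostOrthogonal_iff hv hw
  have hs : MeasurableSet {x : ChannelVec r | u < ‖x‖ ^ 2 ∧ AlmostOrthogonal ε w x} :=
    (measurableSet_norm_sq_gt u).inter
      (measurable_prodMk_left (measurableSet_almostOrthogonal ε))
  conv_rhs => rw [← channelLaw_map_isometry U,
    Measure.map_apply U.continuous.measurable hs]
  congr 1
  ext x
  simp only [Set.mem_preimage, Set.mem_ofPred_eq, hU, U.norm_map]

theorem channelLaw_singleton_zero {r : ℕ} (hr : 1 ≤ r) : channelLaw r {0} = 0 := by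
  refine measure_mono_null (fun x hx => ?_) (channelLaw_sphere hr 0)
  simp_all

/-- The left side does not depend on `v`, so `v` may be drawn at random from the channel law itself.
Integrating over that random vector first, with `x` fixed, gives a probability that does not depend
on the direction of `x`, and the product form appears. -/
theorem channelLaw_almostOrthogonal_eq_mul {r : ℕ} (hr : 1 ≤ r) {v e : ChannelVec r}
    (hv : v ≠ 0) (he : e ≠ 0) (ε : ℝ) {u : ℝ} (hu : 0 ≤ u) :
    channelLaw r {x | u < ‖x‖ ^ 2 ∧ AlmostOrthogonal ε v x}
      = channelLaw r {x | AlmostOrthogonal ε x e} * channelLaw r {x | u < ‖x‖ ^ 2} := by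
  set ν := channelLaw r with hν
  have hs : MeasurableSet {q : ChannelVec r × ChannelVec r |
      u < ‖q.2‖ ^ 2 ∧ AlmostOrthogonal ε q.1 q.2} :=
    (measurable_snd (measurableSet_norm_sq_gt u)).inter (measurableSet_almostOrthogonal ε)
  have h0 : ∀ᵐ w ∂ν, w ≠ 0 := by
    rw [ae_iff]; simpa using channelLaw_singleton_zero hr
  have h1 : (ν.prod ν) {q | u < ‖q.2‖ ^ 2 ∧ AlmostOrthogonal ε q.1 q.2}
      = ν {x | u < ‖x‖ ^ 2 ∧ AlmostOrthogonal ε v x} := by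
    rw [Measure.prod_apply hs]
    calc _ = ∫⁻ _, ν {x | u < ‖x‖ ^ 2 ∧ AlmostOrthogonal ε v x} ∂ν := by
          refine lintegral_congr_ae ?_
          filter_upwards [h0] with w hw
          exact channelLaw_almostOrthogonal_congr hw hv ε u
      _ = _ := by simp
  rw [← h1, Measure.prod_apply_symm hs, ← lintegral_indicator_const (measurableSet_norm_sq_gt u)]
  refine lintegral_congr fun x => ?_
  by_cases hx : u < ‖x‖ ^ 2
  · have hx0 : x ≠ 0 := by
      rintro rfl
      simp at hx; linarith
    rw [Set.indicator_of_mem (by exact hx)]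
    -- The level `-1` makes the norm condition vacuous.
    have := channelLaw_almostOrthogonal_congr hx0 he ε (-1)
    simp only [(neg_one_lt_zero.trans_le (sq_nonneg _)), true_and] at this
    have e1 : (fun w => (w, x)) ⁻¹' {q : ChannelVec r × ChannelVec r |
        u < ‖q.2‖ ^ 2 ∧ AlmostOrthogonal ε q.1 q.2} = {w | AlmostOrthogonal ε x w} := by
      ext w; simp [hx, almostOrthogonal_comm (v := w)]
    rw [e1, this]
    simp only [almostOrthogonal_comm (v := e)]
    rfl
  · rw [Set.indicator_of_notMem (by exact hx)]
    simp [hx]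

/-- As `ε` decreases to `0` these events shrink to a subset of the null event that the first entry
vanishes. -/
theorem exists_channelLaw_almostOrthogonal_le {r : ℕ} (hr : 1 ≤ r) :
    ∃ ε : ℝ, 0 < ε ∧ ∃ e : ChannelVec r, e ≠ 0 ∧
      channelLaw r {x | AlmostOrthogonal ε x e} ≤ 1 / 2 := by
  set e : ChannelVec r := EuclideanSpace.single ⟨0, hr⟩ 1 with he
  have hen : ‖e‖ = 1 := by simp [he]
  have hm : ∀ ε : ℝ, MeasurableSet {x : ChannelVec r | AlmostOrthogonal ε x e} := fun ε =>
    measurable_prodMk_right (measurableSet_almostOrthogonal ε)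
  have hanti : Antitone fun n : ℕ => {x : ChannelVec r | AlmostOrthogonal (1 / (n + 1)) x e} := by
    intro m n hmn x hx
    refine lt_of_lt_of_le (show ‖inner ℂ x e‖ ^ 2 < _ from hx) ?_
    exact mul_le_mul_of_nonneg_right (Nat.one_div_le_one_div hmn) (by positivity)
  have hlim := tendsto_measure_iInter_atTop (μ := channelLaw r)
    (fun n : ℕ => (hm (1 / (n + 1))).nullMeasurableSet) hanti ⟨0, measure_ne_top _ _⟩
  have hz : channelLaw r (⋂ n : ℕ, {x | AlmostOrthogonal (1 / (n + 1)) x e}) = 0 := by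
    refine measure_mono_null (fun x hx => ?_) (channelLaw_apply_eq_zero (⟨0, hr⟩ : Fin r))
    simp only [Set.mem_iInter, Set.mem_ofPred_eq, AlmostOrthogonal] at hx
    have h2 : Filter.Tendsto (fun n : ℕ => 1 / ((n : ℝ) + 1) * (‖x‖ ^ 2 * ‖e‖ ^ 2))
        Filter.atTop (nhds (0 * (‖x‖ ^ 2 * ‖e‖ ^ 2))) :=
      tendsto_one_div_add_atTop_nhds_zero_nat.mul_const _
    have h3 : ‖inner ℂ x e‖ ^ 2 ≤ 0 := by
      rw [zero_mul] at h2
      exact ge_of_tendsto' h2 fun n => (hx n).le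
    have h4 : inner ℂ x e = 0 := by
      have := sq_nonneg ‖inner ℂ x e‖
      simpa using le_antisymm h3 this
    rw [he, EuclideanSpace.inner_single_right] at h4
    simpa using h4
  rw [hz] at hlim
  obtain ⟨n, hn⟩ := (hlim.eventually (ge_mem_nhds (show (0 : ℝ≥0∞) < 1 / 2 by simp))).exists
  exact ⟨1 / (n + 1), by positivity, e, by rintro h; simp [h] at hen, hn⟩

/-- With conditional probability at least `1/2` given a large norm, a channel vector is not almost
orthogonal to a fixed direction. -/
theorem exists_half_le_channelLaw_inner {r : ℕ} (hr : 1 ≤ r) :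
    ∃ ε : ℝ, 0 < ε ∧ ∀ u : ℝ, 0 ≤ u → ∀ v : ChannelVec r, ‖v‖ = 1 →
      1 / 2 * channelLaw r {x | u < ‖x‖ ^ 2}
        ≤ channelLaw r {x | u < ‖x‖ ^ 2 ∧ ε * u ≤ ‖inner ℂ v x‖ ^ 2} := by
  obtain ⟨ε, hε, e, he, h⟩ := exists_channelLaw_almostOrthogonal_le hr
  refine ⟨ε, hε, fun u hu v hv => ?_⟩
  have hv0 : v ≠ 0 := by rintro rfl; simp at hv
  set p := channelLaw r {x | u < ‖x‖ ^ 2} with hp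
  have h1 : channelLaw r {x | u < ‖x‖ ^ 2 ∧ AlmostOrthogonal ε v x} ≤ 1 / 2 * p := by
    rw [channelLaw_almostOrthogonal_eq_mul hr hv0 he ε hu]
    gcongr
  have h2 : p ≤ channelLaw r {x | u < ‖x‖ ^ 2 ∧ ε * u ≤ ‖inner ℂ v x‖ ^ 2}
      + channelLaw r {x | u < ‖x‖ ^ 2 ∧ AlmostOrthogonal ε v x} := by
    refine (measure_mono fun x hx => ?_).trans (measure_union_le _ _)
    by_cases hA : AlmostOrthogonal ε v x
    · exact Or.inr ⟨hx, hA⟩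
    · refine Or.inl ⟨hx, ?_⟩
      have h3 : ε * (‖v‖ ^ 2 * ‖x‖ ^ 2) ≤ ‖inner ℂ v x‖ ^ 2 := not_lt.mp hA
      have h4 : u < ‖x‖ ^ 2 := hx
      rw [hv, one_pow, one_mul] at h3
      exact (mul_le_mul_of_nonneg_left h4.le hε.le).trans h3
  have h3 : p ≤ channelLaw r {x | u < ‖x‖ ^ 2 ∧ ε * u ≤ ‖inner ℂ v x‖ ^ 2} + 1 / 2 * p :=
    h2.trans (by gcongr)
  have h4 : p = 1 / 2 * p + 1 / 2 * p := by
    rw [← add_mul, ENNReal.add_halves, one_mul]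
  have h5 : 1 / 2 * p ≠ ∞ := ENNReal.mul_ne_top (by simp) (measure_ne_top _ _)
  exact (ENNReal.add_le_add_iff_right h5).mp (h4 ▸ h3)

/-! ### A binomial variable lies below its mean with probability bounded away from zero -/

/-- Third-order Taylor bound: `5/18 = 1/2 - 2/9`, with `2/9` the constant of the cubic remainder. -/
theorem one_sub_exp_neg_le {s : ℝ} (h0 : 0 ≤ s) (h1 : s ≤ 1) :
    1 - Real.exp (-s) ≤ s - 5 / 18 * s ^ 2 := by
  have h := Real.exp_bound (x := -s) (by rw [abs_neg, abs_of_nonneg h0]; exact h1)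
    (n := 3) (by norm_num)
  rw [abs_neg, abs_of_nonneg h0] at h
  have h2 := (abs_le.mp h).1
  simp [Finset.sum_range_succ, Nat.factorial] at h2
  nlinarith [mul_nonneg (sq_nonneg s) (sub_nonneg.mpr h1)]

theorem le_one_sub_exp_neg {x : ℝ} (h0 : 0 ≤ x) (h1 : x ≤ 1) :
    x - x ^ 2 ≤ 1 - Real.exp (-x) := by
  have h := Real.abs_exp_sub_one_sub_id_le (x := -x) (by rw [abs_neg, abs_of_nonneg h0]; exact h1)
  have h2 := (abs_le.mp h).2
  linarith [neg_sq x]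

/-- Lower bound for the normalized moment generating function of a binomial variable of mean
`r`. -/
theorem le_binomial_mgf {r K : ℕ} (hr : 1 ≤ r) (hK : 36 * r ≤ K) {s : ℝ} (h0 : 0 < s)
    (h1 : s ≤ 1 / 2) (hs : 4 * (r : ℝ) * s ^ 2 = 1) :
    1 + 1 / 20 ≤ Real.exp (s * r) * (1 - (r : ℝ) / K * (1 - Real.exp (-s))) ^ K := by
  have hr' : (1 : ℝ) ≤ r := by exact_mod_cast hr
  have hK' : 36 * (r : ℝ) ≤ K := by exact_mod_cast hK
  have hK0 : (0 : ℝ) < K := by linarith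
  set z := 1 - Real.exp (-s) with hz
  have hz0 : 0 ≤ z := by
    have : Real.exp (-s) ≤ 1 := Real.exp_le_one_iff.mpr (by linarith)
    linarith
  have hz1 := one_sub_exp_neg_le h0.le (by linarith)
  have hzs : z ≤ s := hz1.trans (by nlinarith)
  set y := (r : ℝ) / K * z with hy
  have hp : (r : ℝ) / K ≤ 1 / 36 := by rw [div_le_iff₀ hK0]; linarith
  have hp0 : 0 ≤ (r : ℝ) / K := by positivity
  have hy0 : 0 ≤ y := by positivity
  have hy1 : y ≤ 1 / 2 := by nlinarith
  have hKy : K * y = r * z := by rw [hy]; field_simp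
  have hlog : -(y + 2 * y ^ 2) ≤ Real.log (1 - y) := by
    refine le_trans ?_ (Real.one_sub_inv_le_log_of_pos (by linarith))
    have : (1 - y)⁻¹ ≤ 1 + y + 2 * y ^ 2 := by
      rw [inv_le_iff_one_le_mul₀ (by linarith)]
      nlinarith [mul_nonneg (sq_nonneg y) (sub_nonneg.mpr hy1)]
    linarith
  have hexp : Real.exp (-(y + 2 * y ^ 2)) ≤ 1 - y := by
    rwa [← Real.le_log_iff_exp_le (by linarith)]
  have hpow : Real.exp (-(y + 2 * y ^ 2)) ^ K ≤ (1 - y) ^ K :=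
    pow_le_pow_left₀ (Real.exp_pos _).le hexp K
  have hmain : Real.exp (1 / 20) ≤ Real.exp (s * r) * Real.exp (-(y + 2 * y ^ 2)) ^ K := by
    rw [← Real.exp_nat_mul, ← Real.exp_add]
    refine Real.exp_le_exp.mpr ?_
    have e : (K : ℝ) * -(y + 2 * y ^ 2) = -(r * z) - 2 * (r * z) * y := by rw [← hKy]; ring
    rw [e]
    -- The total exponent is at least `r s² (5/18 - 2/36) = 1/18`; the factor `36` in `hK` keeps the
    -- second-order loss below the gain.
    have h2 : (r : ℝ) * z ≤ r * (s - 5 / 18 * s ^ 2) := by gcongr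
    have h3 : (r : ℝ) * z * y ≤ (r * s) * (1 / 36 * s) := by
      have : y ≤ 1 / 36 * s := by rw [hy]; gcongr
      gcongr
    nlinarith
  have := Real.add_one_le_exp (1 / 20 : ℝ)
  calc (1 : ℝ) + 1 / 20 ≤ Real.exp (1 / 20) := by linarith
    _ ≤ _ := hmain
    _ ≤ _ := by gcongr

/-- Upper bound for the normalized moment generating function of a binomial variable of mean
`r`. -/
theorem binomial_mgf_le {r K : ℕ} (hr : 1 ≤ r) (hK : r ≤ K) {x : ℝ} (h0 : 0 < x)
    (h1 : x ≤ 1) (hs : (r : ℝ) * x ^ 2 = 1) :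
    Real.exp (x * r) * (1 - (r : ℝ) / K * (1 - Real.exp (-x))) ^ K ≤ 3 := by
  have hr' : (1 : ℝ) ≤ r := by exact_mod_cast hr
  have hK' : (r : ℝ) ≤ K := by exact_mod_cast hK
  have hK0 : (0 : ℝ) < K := by linarith
  set z := 1 - Real.exp (-x) with hz
  have hz1 : z ≤ 1 := by have := Real.exp_pos (-x); linarith
  have hz2 : x - x ^ 2 ≤ z := le_one_sub_exp_neg h0.le h1
  have hz0 : 0 ≤ z := le_trans (by nlinarith) hz2
  have hp : (r : ℝ) / K ≤ 1 := by rw [div_le_iff₀ hK0]; linarith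
  have hp0 : 0 ≤ (r : ℝ) / K := by positivity
  have hy : (r : ℝ) / K * z ≤ 1 := by nlinarith
  have hpow : (1 - (r : ℝ) / K * z) ^ K ≤ Real.exp (-((r : ℝ) / K * z)) ^ K :=
    pow_le_pow_left₀ (by linarith) (Real.one_sub_le_exp_neg _) K
  calc _ ≤ Real.exp (x * r) * Real.exp (-((r : ℝ) / K * z)) ^ K := by gcongr
    _ ≤ Real.exp 1 := by
      rw [← Real.exp_nat_mul, ← Real.exp_add]
      refine Real.exp_le_exp.mpr ?_
      have e : (K : ℝ) * -((r : ℝ) / K * z) = -(r * z) := by field_simp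
      rw [e]
      have : (r : ℝ) * (x - x ^ 2) ≤ r * z := by gcongr
      nlinarith
    _ ≤ 3 := by linarith [Real.exp_one_lt_d9]

open Classical in
-- The integrand is a product of independent factors, one per coordinate.
theorem integral_pow_card_filter {ι X : Type*} [Fintype ι] [MeasurableSpace X] (ν : Measure X)
    [IsProbabilityMeasure ν] {A : Set X} (hA : MeasurableSet A) (a : ℝ) :
    ∫ x, a ^ (Finset.univ.filter fun i : ι => x i ∈ A).card ∂(Measure.pi fun _ : ι => ν)
      = (1 - ν.real A * (1 - a)) ^ Fintype.card ι := by
  have e : ∀ x : ι → X, a ^ (Finset.univ.filter fun i : ι => x i ∈ A).card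
      = ∏ i, (fun y => 1 - A.indicator (fun _ => 1 - a) y) (x i) := by
    intro x
    rw [← Finset.prod_const, Finset.prod_filter]
    refine Finset.prod_congr rfl fun i _ => ?_
    by_cases h : x i ∈ A <;> simp [h]
  rw [integral_congr_ae (.of_forall e),
    integral_fintype_prod_eq_pow (fun y => 1 - A.indicator (fun _ => 1 - a) y), integral_sub (integrable_const _)
    ((integrable_const _).indicator hA), integral_indicator_const _ hA]
  simp

open Classical in
theorem measurable_card_filter_mem {ι X : Type*} [Fintype ι] [MeasurableSpace X]
    {A : Set X} (hA : MeasurableSet A) :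
    Measurable fun x : ι → X => (Finset.univ.filter fun i : ι => x i ∈ A).card := by
  simp_rw [Finset.card_filter]
  exact Finset.measurable_sum _ fun i _ =>
    Measurable.ite (measurable_pi_apply i hA) measurable_const measurable_const

open Classical in
/-- A binomial variable with integer mean `r` lies strictly below its mean with a probability
bounded away from `0`. -/
theorem binomial_lt_mean {X : Type*} [MeasurableSpace X] (ν : Measure X)
    [IsProbabilityMeasure ν] {A : Set X} (hA : MeasurableSet A) {r K : ℕ} (hr : 1 ≤ r)
    (hK : 36 * r ≤ K) (hp : ν.real A = (r : ℝ) / K) :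
    1 / 1200 ≤ (Measure.pi fun _ : Fin K => ν).real
      {x | (Finset.univ.filter fun i : Fin K => x i ∈ A).card < r} := by
  set μ := Measure.pi fun _ : Fin K => ν
  set N : (Fin K → X) → ℕ := fun x => (Finset.univ.filter fun i : Fin K => x i ∈ A).card with hN
  have hNm : Measurable N := measurable_card_filter_mem hA
  have hr' : (1 : ℝ) ≤ r := by exact_mod_cast hr
  -- At the scale `1/√r` of the standard deviation, `W = exp (s (r - N))` has mean at least `1 +
  -- 1/20` and second moment at most `3`, uniformly in `r`.
  set s : ℝ := 1 / (2 * Real.sqrt r) with hs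
  have hsq : 1 ≤ Real.sqrt r := Real.one_le_sqrt.mpr hr'
  have hs0 : 0 < s := by positivity
  have hs1 : s ≤ 1 / 2 := by
    rw [hs]; gcongr; linarith
  have hss : 4 * (r : ℝ) * s ^ 2 = 1 := by
    rw [hs, div_pow, mul_pow, Real.sq_sqrt (by positivity)]; field_simp; norm_num
  set W : (Fin K → X) → ℝ := fun x => Real.exp (s * r) * Real.exp (-s) ^ N x with hW
  have hWint : ∫ x, W x ∂μ = Real.exp (s * r) * (1 - (r : ℝ) / K * (1 - Real.exp (-s))) ^ K := by
    rw [hW, integral_const_mul, integral_pow_card_filter ν hA, hp, Fintype.card_fin]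
  have hW2 : ∀ x, W x ^ 2 = Real.exp (2 * s * r) * Real.exp (-(2 * s)) ^ N x := by
    intro x
    simp only [hW]
    rw [mul_pow, ← pow_mul, mul_comm (N x), pow_mul, ← Real.exp_nat_mul, ← Real.exp_nat_mul]
    push_cast
    ring_nf
  have hW2int : ∫ x, W x ^ 2 ∂μ
      = Real.exp (2 * s * r) * (1 - (r : ℝ) / K * (1 - Real.exp (-(2 * s)))) ^ K := by
    simp_rw [hW2]
    rw [integral_const_mul, integral_pow_card_filter ν hA, hp, Fintype.card_fin]
  have hWm : Measurable W :=
    measurable_const.mul ((measurable_from_nat (f := fun n => Real.exp (-s) ^ n)).comp hNm)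
  have hW0 : ∀ x, 0 ≤ W x := fun x => by positivity
  have hWb : ∀ x, W x ≤ Real.exp (s * r) := fun x =>
    mul_le_of_le_one_right (by positivity)
      (pow_le_one₀ (Real.exp_pos _).le (Real.exp_le_one_iff.mpr (by linarith)))
  have hWi : Integrable W μ := Integrable.of_bound hWm.aestronglyMeasurable (Real.exp (s * r))
    (.of_forall fun x => by rw [Real.norm_of_nonneg (hW0 x)]; exact hWb x)
  have hW2i : Integrable (fun x => W x ^ 2) μ :=
    Integrable.of_bound (hWm.pow_const 2).aestronglyMeasurable (Real.exp (s * r) ^ 2)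
    (.of_forall fun x => by
      rw [Real.norm_of_nonneg (sq_nonneg _)]; exact pow_le_pow_left₀ (hW0 x) (hWb x) 2)
  have hB : MeasurableSet {x | N x < r} := measurableSet_lt hNm measurable_const
  -- On `N < r` this is `(W - 60)² ≥ 0`; elsewhere `W ≤ 1`. Integrating gives `1/20 ≤ 3/120 + 30 q`
  -- for the probability `q` of `N < r`, that is `q ≥ 1/1200`.
  have hpt : ∀ x, W x - 1 ≤ W x ^ 2 / 120 + {x | N x < r}.indicator (fun _ => (30 : ℝ)) x := by
    intro x
    by_cases hx : N x < r
    · rw [Set.indicator_of_mem (by exact hx)]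
      nlinarith [sq_nonneg (W x - 60)]
    · rw [Set.indicator_of_notMem (by exact hx)]
      have h1 : W x ≤ 1 := by
        simp only [hW]
        rw [← Real.exp_nat_mul, ← Real.exp_add, Real.exp_le_one_iff]
        have : (r : ℝ) ≤ N x := by exact_mod_cast not_lt.mp hx
        nlinarith
      nlinarith [sq_nonneg (W x)]
  have hint := integral_mono (hWi.sub (integrable_const 1))
    ((hW2i.div_const 120).add ((integrable_const (30 : ℝ)).indicator hB)) hpt
  simp only [Pi.sub_apply, Pi.add_apply] at hint
  rw [integral_sub hWi (integrable_const 1), integral_add (hW2i.div_const 120)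
    ((integrable_const (30 : ℝ)).indicator hB), integral_indicator_const _ hB, integral_div,
    hWint, hW2int] at hint
  have h1 := le_binomial_mgf hr hK hs0 hs1 hss
  have h2 := binomial_mgf_le (x := 2 * s) hr (by omega : r ≤ K) (by linarith) (by linarith)
    (by nlinarith)
  simp only [integral_const, probReal_univ, smul_eq_mul, one_mul] at hint
  linarith

/-! ### The zero-forcing gain -/

theorem zfGain_nonneg {r K : ℕ} (h : Fin K → ChannelVec r) (S : Finset (Fin K)) (i : Fin K) :
    0 ≤ zfGain h S i := sq_nonneg _

theorem zfGain_le_norm_sq {r K : ℕ} (h : Fin K → ChannelVec r) (S : Finset (Fin K)) (i : Fin K) :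
    zfGain h S i ≤ ‖h i‖ ^ 2 :=
  pow_le_pow_left₀ (norm_nonneg _) (Submodule.norm_starProjection_apply_le _ _) 2

theorem norm_inner_sq_le_zfGain {r K : ℕ} (h : Fin K → ChannelVec r) (S : Finset (Fin K))
    (i : Fin K) {v : ChannelVec r} (hv : ‖v‖ = 1)
    (ho : ∀ l ∈ S, l ≠ i → inner ℂ (h l) v = 0) : ‖inner ℂ v (h i)‖ ^ 2 ≤ zfGain h S i := by
  unfold zfGain
  set W := Submodule.span ℂ (h '' {l | l ∈ S ∧ l ≠ i})
  have hvW : v ∈ Wᗮ := by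
    refine (Submodule.mem_orthogonal W v).mpr fun w hw => ?_
    induction hw using Submodule.span_induction with
    | mem x hx => obtain ⟨l, hl, rfl⟩ := hx; exact ho l hl.1 hl.2
    | zero => simp
    | add x y _ _ hx hy => rw [inner_add_left, hx, hy, add_zero]
    | smul c x _ hx => rw [inner_smul_left, hx, mul_zero]
  have e : inner ℂ v (h i) = inner ℂ v (Wᗮ.starProjection (h i)) := by
    rw [← Submodule.inner_starProjection_left_eq_right,
      Submodule.starProjection_eq_self_iff.mpr hvW]
  rw [e]
  refine pow_le_pow_left₀ (norm_nonneg _) ((norm_inner_le_norm _ _).trans ?_) 2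
  rw [hv, one_mul]

/-- The gain is the squared distance to the span of the other channels. The projection may jump
where the dimension of the span changes, but this form writes the sublevel sets as unions of open
sets, which gives measurability. -/
theorem zfGain_lt_iff {r K : ℕ} (h : Fin K → ChannelVec r) (S : Finset (Fin K)) (i : Fin K)
    (a : ℝ) : zfGain h S i < a ↔
      ∃ c : Fin K → ℂ, ‖h i - ∑ l ∈ S.erase i, c l • h l‖ ^ 2 < a := by
  unfold zfGain
  have hS : {l | l ∈ S ∧ l ≠ i} = ((S.erase i : Finset (Fin K)) : Set (Fin K)) := by
    ext l; simp [and_comm]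
  set W := Submodule.span ℂ (h '' {l | l ∈ S ∧ l ≠ i}) with hW
  constructor
  · intro hlt
    have hm := Submodule.starProjection_apply_mem W (h i)
    rw [hW, hS] at hm
    obtain ⟨c, hc⟩ := (Submodule.mem_span_image_finset_iff_exists_fun' ℂ).mp hm
    simp only [← hS, ← hW] at hc
    refine ⟨c, ?_⟩
    rw [hc, ← Submodule.starProjection_orthogonal_val]
    exact hlt
  · rintro ⟨c, hc⟩
    refine lt_of_le_of_lt ?_ hc
    have hm : ∑ l ∈ S.erase i, c l • h l ∈ W :=
      Submodule.sum_mem _ fun l hl => Submodule.smul_mem _ _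
        (Submodule.subset_span ⟨l, (Finset.mem_erase.mp hl).symm, rfl⟩)
    have h0 : Wᗮ.starProjection (∑ l ∈ S.erase i, c l • h l) = 0 :=
      Submodule.starProjection_orthogonal_apply_eq_zero hm
    have e : Wᗮ.starProjection (h i)
        = Wᗮ.starProjection (h i - ∑ l ∈ S.erase i, c l • h l) := by
      rw [map_sub, h0, sub_zero]
    rw [e]
    exact pow_le_pow_left₀ (norm_nonneg _) (Submodule.norm_starProjection_apply_le _ _) 2

theorem measurable_zfGain {r K : ℕ} (S : Finset (Fin K)) (i : Fin K) :
    Measurable fun h : Fin K → ChannelVec r => zfGain h S i := by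
  refine measurable_of_Iio fun a => IsOpen.measurableSet ?_
  have e : (fun h : Fin K → ChannelVec r => zfGain h S i) ⁻¹' Set.Iio a
      = ⋃ c : Fin K → ℂ, {h | ‖h i - ∑ l ∈ S.erase i, c l • h l‖ ^ 2 < a} := by
    ext h
    simp [zfGain_lt_iff]
  rw [e]
  exact isOpen_iUnion fun c => isOpen_lt (by fun_prop) continuous_const

theorem exists_unit_orthogonal {r K : ℕ} (h : Fin K → ChannelVec r) (T : Finset (Fin K))
    (hT : T.card < r) : ∃ v : ChannelVec r, ‖v‖ = 1 ∧ ∀ l ∈ T, inner ℂ (h l) v = 0 := by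
  classical
  set W := Submodule.span ℂ ((T.image h : Finset (ChannelVec r)) : Set (ChannelVec r)) with hW
  have h1 : Module.finrank ℂ W ≤ T.card :=
    (finrank_span_finset_le_card (R := ℂ) (T.image h)).trans Finset.card_image_le
  have h2 := W.finrank_add_finrank_orthogonal
  rw [finrank_euclideanSpace_fin] at h2
  have h3 : Wᗮ ≠ ⊥ := by
    intro h0
    rw [h0, finrank_bot] at h2
    omega
  obtain ⟨b, hb, hb0⟩ := Submodule.exists_mem_ne_zero_of_ne_bot h3
  have hbn : ‖b‖ ≠ 0 := norm_ne_zero_iff.mpr hb0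
  refine ⟨((‖b‖⁻¹ : ℝ) : ℂ) • b, by simp [norm_smul, hbn], fun l hl => ?_⟩
  have h4 : h l ∈ W := Submodule.subset_span (by simpa using ⟨l, hl, rfl⟩)
  rw [inner_smul_right, (Submodule.mem_orthogonal W b).mp hb _ h4, mul_zero]

/-! ### Transmitter sets and the resampling bound -/

theorem mem_transmitters {r K : ℕ} {h : Fin K → ChannelVec r} {u : ℝ} {i : Fin K} :
    i ∈ transmitters h u ↔ u < ‖h i‖ ^ 2 := by
  simp [transmitters]

theorem measurableSet_mem_transmitters {r K : ℕ} (u : ℝ) (i : Fin K) :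
    MeasurableSet {h : Fin K → ChannelVec r | i ∈ transmitters h u} := by
  simp only [mem_transmitters]
  exact measurableSet_lt measurable_const (by fun_prop)

theorem measurableSet_transmitters_eq {r K : ℕ} (u : ℝ) (T : Finset (Fin K)) :
    MeasurableSet {h : Fin K → ChannelVec r | transmitters h u = T} := by
  simp only [Finset.ext_iff, Set.ofPred_forall]
  exact MeasurableSet.iInter fun i => by
    by_cases hi : i ∈ T
    · simpa [hi] using measurableSet_mem_transmitters u i
    · simp only [hi, iff_false]
      exact (measurableSet_mem_transmitters u i).compl

/-- A condition that is measurable for each fixed set of transmitters is measurable. -/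
theorem measurableSet_transmitters_of_forall {r K : ℕ} (u : ℝ)
    {p : Finset (Fin K) → (Fin K → ChannelVec r) → Prop}
    (hp : ∀ T, MeasurableSet {h | p T h}) :
    MeasurableSet {h : Fin K → ChannelVec r | p (transmitters h u) h} := by
  have e : {h : Fin K → ChannelVec r | p (transmitters h u) h}
      = ⋃ T, {h | transmitters h u = T} ∩ {h | p T h} := by
    ext h; simp
  rw [e]
  exact MeasurableSet.iUnion fun T => (measurableSet_transmitters_eq u T).inter (hp T)

theorem measurableSet_card_transmitters {r K : ℕ} (u : ℝ) (p : ℕ → Prop) :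
    MeasurableSet {h : Fin K → ChannelVec r | p (transmitters h u).card} :=
  measurableSet_transmitters_of_forall (r := r) u (p := fun T _ => p T.card)
    fun _ => MeasurableSet.const _

theorem transmitters_update {r K : ℕ} (h : Fin K → ChannelVec r) {u : ℝ} (i : Fin K)
    {y : ChannelVec r} (hy : u < ‖y‖ ^ 2) :
    transmitters (Function.update h i y) u = insert i (transmitters h u) := by
  ext l
  rw [Finset.mem_insert, mem_transmitters, mem_transmitters]
  by_cases hl : l = i
  · subst hl; simpa using hy
  · simp [hl]

/-- The event that user `i` transmits, that at most `r` users transmit, and that user `i` has a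
zero-forcing gain of at least `g` within the group assigned to the set of transmitters. -/
def goodEvent {r K : ℕ} (F : Finset (Fin K) → Finset (Fin K)) (u g : ℝ) (i : Fin K) :
    Set (Fin K → ChannelVec r) :=
  {h | i ∈ transmitters h u ∧ (transmitters h u).card ≤ r ∧ g ≤ zfGain h (F (transmitters h u)) i}

theorem measurableSet_goodEvent {r K : ℕ} (F : Finset (Fin K) → Finset (Fin K)) (u g : ℝ)
    (i : Fin K) : MeasurableSet (goodEvent (r := r) F u g i) :=
  measurableSet_transmitters_of_forall (r := r) u
    (p := fun T h => i ∈ T ∧ T.card ≤ r ∧ g ≤ zfGain h (F T) i)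
    fun T => (MeasurableSet.const _).inter ((MeasurableSet.const _).inter
      (measurableSet_le measurable_const (measurable_zfGain (F T) i)))

/-- Resample the channel of user `i`. When fewer than `r` users transmit in `h`, every new channel
above the threshold yields the same set `T`, so the group `F T` and a unit vector orthogonal to its
other channels are fixed before the new channel is drawn. -/
theorem le_usersLaw_goodEvent {r K : ℕ} {u ε : ℝ}
    (hε : ∀ v : ChannelVec r, ‖v‖ = 1 → 1 / 2 * channelLaw r {x | u < ‖x‖ ^ 2}
        ≤ channelLaw r {x | u < ‖x‖ ^ 2 ∧ ε * u ≤ ‖inner ℂ v x‖ ^ 2})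
    {F : Finset (Fin K) → Finset (Fin K)}
    (hF : ∀ S, S.card ≤ r → S ⊆ F S ∧ (F S).card ≤ r) (i : Fin K) :
    1 / 2 * channelLaw r {x | u < ‖x‖ ^ 2} * usersLaw r K {h | (transmitters h u).card < r}
      ≤ usersLaw r K (goodEvent F u (ε * u) i) := by
  rw [usersLaw, measure_pi_eq_lintegral_update (channelLaw r) i (measurableSet_goodEvent F u _ i),
    ← lintegral_indicator_const (measurableSet_card_transmitters u (· < r))]
  refine lintegral_mono fun h => ?_
  by_cases hc : (transmitters h u).card < r
  swap
  · rw [Set.indicator_of_notMem (by exact hc)]; exact zero_le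
  rw [Set.indicator_of_mem (by exact hc)]
  set T := insert i (transmitters h u) with hT
  have hTc : T.card ≤ r := (Finset.card_insert_le _ _).trans hc
  obtain ⟨hsub, hcard⟩ := hF T hTc
  have hi : i ∈ F T := hsub (Finset.mem_insert_self _ _)
  obtain ⟨v, hv, ho⟩ := exists_unit_orthogonal h ((F T).erase i)
    (by rw [Finset.card_erase_of_mem hi]; have := Finset.card_pos.mpr ⟨i, hi⟩; omega)
  refine (hε v hv).trans (measure_mono fun y hy => ?_)
  obtain ⟨hy1, hy2⟩ := hy
  have ht := transmitters_update h i hy1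
  refine ⟨?_, ?_, ?_⟩
  · rw [ht]; exact Finset.mem_insert_self _ _
  · rw [ht]; exact hTc
  · rw [ht]
    have := norm_inner_sq_le_zfGain (Function.update h i y) (F T) i hv (fun l hl hli => by
      rw [Function.update_of_ne hli]; exact ho l (Finset.mem_erase.mpr ⟨hli, hl⟩))
    rw [Function.update_self] at this
    exact hy2.trans this

/-- The expected sum rate of the transmitters when they are scheduled within the group `F S`. -/
theorem le_lintegral_sum_log_zfGain {r K : ℕ} {P u ε : ℝ} (hP : 0 ≤ P)
    (hε : ∀ v : ChannelVec r, ‖v‖ = 1 → 1 / 2 * channelLaw r {x | u < ‖x‖ ^ 2}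
        ≤ channelLaw r {x | u < ‖x‖ ^ 2 ∧ ε * u ≤ ‖inner ℂ v x‖ ^ 2})
    (hεu : 0 ≤ ε * u) {F : Finset (Fin K) → Finset (Fin K)}
    (hF : ∀ S, S.card ≤ r → S ⊆ F S ∧ (F S).card ≤ r) :
    K * (1 / 2 * channelLaw r {x | u < ‖x‖ ^ 2}
        * usersLaw r K {h | (transmitters h u).card < r})
        * ENNReal.ofReal (Real.log (1 + P * (ε * u)))
      ≤ ∫⁻ h, (if (transmitters h u).card ≤ r then ENNReal.ofReal
          (∑ i ∈ transmitters h u, Real.log (1 + P * zfGain h (F (transmitters h u)) i)) else 0)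
          ∂(usersLaw r K) := by
  set c := ENNReal.ofReal (Real.log (1 + P * (ε * u))) with hc
  calc _ = ∑ _i : Fin K, c * (1 / 2 * channelLaw r {x | u < ‖x‖ ^ 2}
        * usersLaw r K {h | (transmitters h u).card < r}) := by
        simp only [Finset.sum_const, Finset.card_univ, Fintype.card_fin, nsmul_eq_mul]; ring
    _ ≤ ∑ i : Fin K, c * usersLaw r K (goodEvent F u (ε * u) i) :=
        Finset.sum_le_sum fun i _ => by gcongr; exact le_usersLaw_goodEvent hε hF i
    _ = ∫⁻ h, ∑ i : Fin K, (goodEvent F u (ε * u) i).indicator (fun _ => c) h ∂(usersLaw r K) := by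
        rw [lintegral_finsetSum _ fun i _ =>
          measurable_const.indicator (measurableSet_goodEvent F u _ i)]
        refine Finset.sum_congr rfl fun i _ => ?_
        rw [lintegral_indicator_const (measurableSet_goodEvent F u _ i)]
    _ ≤ _ := by
        refine lintegral_mono fun h => ?_
        split_ifs with hr
        · rw [ENNReal.ofReal_sum_of_nonneg fun i _ => Real.log_nonneg
            (le_add_of_nonneg_right (mul_nonneg hP (zfGain_nonneg _ _ _)))]
          rw [← Finset.sum_subset (Finset.subset_univ (transmitters h u))]
          · refine Finset.sum_le_sum fun i hi => ?_
            by_cases hg : h ∈ goodEvent F u (ε * u) i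
            swap
            · rw [Set.indicator_of_notMem hg]; exact zero_le
            rw [Set.indicator_of_mem hg]
            refine ENNReal.ofReal_le_ofReal (Real.log_le_log (by positivity) ?_)
            have := hg.2.2
            gcongr
          · intro i _ hi
            exact Set.indicator_of_notMem (fun hg => hi hg.1) _
        · refine (Finset.sum_eq_zero fun i _ => Set.indicator_of_notMem (fun hg => hr hg.2.1) _).le

/-! ### Existence and size of thresholds -/

theorem usersLaw_eval {r K : ℕ} (i : Fin K) {s : Set (ChannelVec r)} (hs : MeasurableSet s) :
    usersLaw r K {h | h i ∈ s} = channelLaw r s :=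
  (measurePreserving_eval (fun _ : Fin K => channelLaw r) i).measure_preimage hs.nullMeasurableSet

theorem isThreshold_iff {r K : ℕ} {k u : ℝ} :
    IsThreshold r K k u ↔ K * channelLaw r {x | u < ‖x‖ ^ 2} = ENNReal.ofReal k := by
  unfold IsThreshold
  have e : ∀ h : Fin K → ChannelVec r, ((transmitters h u).card : ℝ≥0∞)
      = ∑ i, {h : Fin K → ChannelVec r | i ∈ transmitters h u}.indicator 1 h := by
    intro h
    simp [Set.indicator_apply, Finset.sum_ite_mem]
  simp_rw [e]
  rw [lintegral_finsetSum _ fun i _ =>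
    measurable_one.indicator (measurableSet_mem_transmitters u i)]
  have e2 : ∀ i : Fin K, ∫⁻ h, {h : Fin K → ChannelVec r | i ∈ transmitters h u}.indicator 1 h
      ∂(usersLaw r K) = channelLaw r {x | u < ‖x‖ ^ 2} := by
    intro i
    rw [lintegral_indicator_one (measurableSet_mem_transmitters u i),
      ← usersLaw_eval i (measurableSet_norm_sq_gt u)]
    simp only [mem_transmitters, Set.mem_ofPred_eq]
  simp_rw [e2]
  simp

theorem IsThreshold.real_channelLaw {r K : ℕ} {k u : ℝ} (hk : 0 ≤ k) (hK : 0 < K)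
    (h : IsThreshold r K k u) : (channelLaw r).real {x | u < ‖x‖ ^ 2} = k / K := by
  have h1 := congrArg ENNReal.toReal (isThreshold_iff.mp h)
  rw [ENNReal.toReal_mul, ENNReal.toReal_ofReal hk, ENNReal.toReal_natCast] at h1
  have : (0 : ℝ) < K := by exact_mod_cast hK
  rw [eq_div_iff this.ne', mul_comm]
  exact h1

/-- The jump of the distribution function at `a` is the mass of `{a}`. -/
theorem continuous_cdf_of_noAtoms (μ : Measure ℝ) [IsProbabilityMeasure μ]
    (h : ∀ a, μ {a} = 0) : Continuous (cdf μ) := by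
  refine continuous_iff_continuousAt.mpr fun a => ?_
  rw [(cdf μ).mono.continuousAt_iff_leftLim_eq_rightLim, (cdf μ).rightLim_eq]
  have h1 := (cdf μ).measure_singleton a
  rw [measure_cdf, h a] at h1
  have h2 := ENNReal.ofReal_eq_zero.mp h1.symm
  exact le_antisymm ((cdf μ).mono.leftLim_le le_rfl) (by linarith)

theorem exists_isThreshold {r K : ℕ} (hr : 1 ≤ r) (hK : r < K) :
    ∃ u : ℝ, IsThreshold r K r u := by
  have hm : Measurable fun x : ChannelVec r => ‖x‖ ^ 2 := by fun_prop
  set μ := (channelLaw r).map fun x => ‖x‖ ^ 2 with hμ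
  have : IsProbabilityMeasure μ := Measure.isProbabilityMeasure_map hm.aemeasurable
  have hc : Continuous (cdf μ) := continuous_cdf_of_noAtoms μ fun a => by
    rw [hμ, Measure.map_apply hm (measurableSet_singleton a)]
    exact channelLaw_sphere hr a
  have hK0 : (0 : ℝ) < K := by exact_mod_cast (by omega : 0 < K)
  have hr0 : (0 : ℝ) < r := by exact_mod_cast (by omega : 0 < r)
  have hrK : (r : ℝ) < K := by exact_mod_cast hK
  have hq1 : 0 < 1 - (r : ℝ) / K := sub_pos.mpr ((div_lt_one hK0).mpr hrK)
  have hq2 : 1 - (r : ℝ) / K < 1 := sub_lt_self _ (by positivity)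
  obtain ⟨a, ha⟩ := ((tendsto_cdf_atBot μ).eventually (ge_mem_nhds hq1)).exists
  obtain ⟨b, hb⟩ := ((tendsto_cdf_atTop μ).eventually (le_mem_nhds hq2)).exists
  obtain ⟨u, hu⟩ := mem_range_of_exists_le_of_exists_ge hc ⟨a, ha⟩ ⟨b, hb⟩
  refine ⟨u, isThreshold_iff.mpr ?_⟩
  have h1 : channelLaw r {x | u < ‖x‖ ^ 2} = ENNReal.ofReal (r / K) := by
    have e : {x : ChannelVec r | u < ‖x‖ ^ 2} = (fun x => ‖x‖ ^ 2) ⁻¹' (Set.Iic u)ᶜ := by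
      ext x; simp
    rw [e, ← Measure.map_apply hm measurableSet_Iic.compl, ← hμ,
      prob_compl_eq_one_sub measurableSet_Iic, ← ofReal_cdf, hu, ← ENNReal.ofReal_one,
      ← ENNReal.ofReal_sub _ hq1.le]
    congr 1; ring
  rw [h1, ← ENNReal.ofReal_natCast K, ← ENNReal.ofReal_mul hK0.le]
  congr 1
  field_simp

/-- A threshold that `r` users exceed on average is of order at least `log K`. -/
theorem exists_log_le_threshold {r : ℕ} (hr : 1 ≤ r) : ∃ M : ℝ, ∀ K : ℕ, M ≤ K → ∀ u : ℝ,
    IsThreshold r K r u → Real.log K / 4 ≤ u := by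
  obtain ⟨b, hb, htail⟩ := exists_exp_le_channelLaw_tail
  -- With `K > r` the threshold cannot be negative, since then all users would transmit. With `K ≥
  -- (r / b)²` the term `log (r / b)` costs at most half of `log K`.
  refine ⟨max (r + 1) ((r / b) ^ 2), fun K hK u hu => ?_⟩
  have hr0 : (1 : ℝ) ≤ r := by exact_mod_cast hr
  have hK1 := (le_max_left _ _).trans hK
  have hK2 := (le_max_right _ _).trans hK
  have hK0 : (0 : ℝ) < K := by linarith
  have hp := hu.real_channelLaw (by positivity) (by exact_mod_cast hK0)
  rcases lt_or_ge u 0 with h0 | h0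
  · exfalso
    have e : {x : ChannelVec r | u < ‖x‖ ^ 2} = Set.univ := by
      ext x; simpa using h0.trans_le (sq_nonneg ‖x‖)
    rw [e, probReal_univ, eq_div_iff hK0.ne'] at hp
    linarith
  · have h1 := htail r hr u h0
    rw [← ofReal_measureReal, ENNReal.ofReal_le_ofReal_iff measureReal_nonneg, hp,
      le_div_iff₀ hK0] at h1
    have h2 : (K : ℝ) ≤ r / b * Real.exp (2 * u) := by
      rw [Real.exp_neg] at h1
      have he := Real.exp_pos (2 * u)
      rw [div_mul_eq_mul_div, le_div_iff₀ hb]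
      calc (K : ℝ) * b = (b * (Real.exp (2 * u))⁻¹ * K) * Real.exp (2 * u) := by field_simp
        _ ≤ _ := by gcongr
    have h3 : Real.log K ≤ Real.log (r / b) + 2 * u := by
      have := Real.log_le_log hK0 h2
      rwa [Real.log_mul (by positivity) (by positivity), Real.log_exp] at this
    have h4 : 2 * Real.log (r / b) ≤ Real.log K := by
      have := Real.log_le_log (by positivity) hK2
      rwa [Real.log_pow, Nat.cast_ofNat] at this
    linarith

/-! ### Lower bound on the rate -/

/-- Scheduling the transmitters within a group of at most `r` users yields a rate of the order
`r log (P log K)`. -/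
theorem exists_le_lintegral_sum_log_zfGain {r : ℕ} (hr : 1 ≤ r) :
    ∃ M : ℝ, ∀ (K : ℕ) (P : ℝ), 0 < P → M ≤ K → M ≤ P * Real.log K → ∀ u : ℝ,
      IsThreshold r K r u → ∀ F : Finset (Fin K) → Finset (Fin K),
      (∀ S, S.card ≤ r → S ⊆ F S ∧ (F S).card ≤ r) →
      ENNReal.ofReal (1 / 4800 * (r * Real.log (P * Real.log K)))
      ≤ ∫⁻ h, (if (transmitters h u).card ≤ r then ENNReal.ofReal
          (∑ i ∈ transmitters h u, Real.log (1 + P * zfGain h (F (transmitters h u)) i)) else 0)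
          ∂(usersLaw r K) := by
  obtain ⟨ε, hε, hang⟩ := exists_half_le_channelLaw_inner hr
  obtain ⟨M₀, hM₀⟩ := exists_log_le_threshold hr
  refine ⟨max (max M₀ (36 * r)) (max 1 ((4 / ε) ^ 2)), fun K P hP hK hPL u hu F hF => ?_⟩
  have hK1 := hM₀ K ((le_max_left _ _).trans ((le_max_left _ _).trans hK)) u hu
  have hK2 : 36 * (r : ℝ) ≤ K := (le_max_right _ _).trans ((le_max_left _ _).trans hK)
  have hP1 : 1 ≤ P * Real.log K := (le_max_left _ _).trans ((le_max_right _ _).trans hPL)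
  have hP2 : (4 / ε) ^ 2 ≤ P * Real.log K := (le_max_right _ _).trans ((le_max_right _ _).trans hPL)
  have hK3 : 36 * r ≤ K := by exact_mod_cast hK2
  have hr0 : (1 : ℝ) ≤ r := by exact_mod_cast hr
  have hK0 : (0 : ℝ) < K := by linarith
  have hL : 0 < Real.log K := by
    by_contra hneg
    nlinarith [not_lt.mp hneg]
  have hu0 : 0 ≤ u := by linarith
  have hp := hu.real_channelLaw (by positivity) (by exact_mod_cast hK0)
  have hq := binomial_lt_mean (channelLaw r) (measurableSet_norm_sq_gt u) hr hK3 hp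
  have hq' : ENNReal.ofReal (1 / 1200) ≤ usersLaw r K {h | (transmitters h u).card < r} := by
    rw [← ofReal_measureReal]
    refine ENNReal.ofReal_le_ofReal (hq.trans_eq ?_)
    rw [usersLaw]
    congr 1
  have hlog : 1 / 2 * Real.log (P * Real.log K) ≤ Real.log (1 + P * (ε * u)) := by
    have h1 : P * Real.log K * (ε / 4) ≤ 1 + P * (ε * u) := by
      have : P * (ε * (Real.log K / 4)) ≤ P * (ε * u) := by gcongr
      linarith
    -- The bound `P log K ≥ (4 / ε)²` trades the factor `ε / 4`, which depends on `r`, for a factor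
    -- `1/2` in front of the logarithm.
    have h2 : P * Real.log K ≤ (P * Real.log K * (ε / 4)) ^ 2 := by
      have h3 : 1 ≤ P * Real.log K * (ε / 4) ^ 2 := by
        calc (1 : ℝ) = (4 / ε) ^ 2 * (ε / 4) ^ 2 := by field_simp
          _ ≤ _ := by gcongr
      nlinarith
    have h4 := Real.log_le_log (by linarith) h2
    rw [Real.log_pow, Nat.cast_ofNat] at h4
    have h5 := Real.log_le_log (by positivity) h1
    linarith
  refine le_trans ?_ (le_lintegral_sum_log_zfGain hP.le (hang u hu0) (by positivity) hF)
  have hKp : (K : ℝ≥0∞) * channelLaw r {x | u < ‖x‖ ^ 2} = ENNReal.ofReal r :=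
    isThreshold_iff.mp hu
  -- `1/4800 = 1/2 · 1/1200 · 1/2`: direction, binomial event, logarithm.
  calc ENNReal.ofReal (1 / 4800 * (r * Real.log (P * Real.log K)))
      = ENNReal.ofReal r * ENNReal.ofReal (1 / 2) * ENNReal.ofReal (1 / 1200)
          * ENNReal.ofReal (1 / 2 * Real.log (P * Real.log K)) := by
        rw [← ENNReal.ofReal_mul (by positivity), ← ENNReal.ofReal_mul (by positivity),
          ← ENNReal.ofReal_mul (by positivity)]
        congr 1; ring
    _ ≤ ENNReal.ofReal r * ENNReal.ofReal (1 / 2)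
          * usersLaw r K {h | (transmitters h u).card < r}
          * ENNReal.ofReal (Real.log (1 + P * (ε * u))) := by
        gcongr
    _ = _ := by
        rw [← hKp, ENNReal.ofReal_div_of_pos (by norm_num), ENNReal.ofReal_one,
          ENNReal.ofReal_ofNat]
        ring

/-! ### Upper bound on the rate -/

/-- The sum rates of all groups of at most `r` users are dominated by a function whose mean is of
the order `r log (P log K)`. -/
theorem exists_dominating_rate (r : ℕ) :
    ∃ M : ℝ, ∀ (K : ℕ) (P : ℝ), 0 < P → M ≤ K → M ≤ P * Real.log K →
      ∃ Z : (Fin K → ChannelVec r) → ℝ≥0∞,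
        (∀ h S, S.card ≤ r → ENNReal.ofReal (zfSumRate P h S) ≤ Z h) ∧
        ∫⁻ h, Z h ∂(usersLaw r K) ≤ ENNReal.ofReal (3 * (r * Real.log (P * Real.log K))) := by
  obtain ⟨a, ha, hA⟩ := exists_exp_moment_channelLaw r
  set A := ∫⁻ x, ENNReal.ofReal (Real.exp (a * ‖x‖ ^ 2)) ∂(channelLaw r) with hAdef
  -- These give `L ≥ 1`, then `1 + P L ≤ (P L)²`, and `(1 + A) / a ≤ log (P L)`; the constant `3` is
  -- `2 + 1`.
  refine ⟨max (Real.exp 1) (max 2 (Real.exp ((1 + A.toReal) / a))), fun K P hP hK hPL => ?_⟩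
  have hK1 : Real.exp 1 ≤ K := (le_max_left _ _).trans hK
  have hK0 : (0 : ℝ) < K := (Real.exp_pos 1).trans_le hK1
  set L := Real.log K with hLdef
  have hL : 1 ≤ L := (Real.le_log_iff_exp_le hK0).mpr hK1
  have hP2 : 2 ≤ P * L := (le_max_left _ _).trans ((le_max_right _ _).trans hPL)
  have hP3 : (1 + A.toReal) / a ≤ Real.log (P * L) :=
    (Real.le_log_iff_exp_le (by linarith)).mpr ((le_max_right _ _).trans ((le_max_right _ _).trans hPL))
  have hrate : ∀ (h : Fin K → ChannelVec r) (i : Fin K) (S : Finset (Fin K)),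
      Real.log (1 + P * zfGain h S i)
        ≤ Real.log (1 + P * L) + 1 / a + 1 / (a * K) * ∑ j, Real.exp (a * ‖h j‖ ^ 2) := by
    intro h i S
    have h0 := zfGain_nonneg h S i
    have h1 := zfGain_le_norm_sq h S i
    set x := ‖h i‖ ^ 2 with hx
    have hx0 : 0 ≤ x := sq_nonneg _
    have h2 : Real.log (1 + P * zfGain h S i) ≤ Real.log ((1 + P * L) * (1 + x / L)) := by
      refine Real.log_le_log (by positivity) ?_
      have e : (1 + P * L) * (1 + x / L) = 1 + P * x + (P * L + x / L) := by field_simp; ring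
      have h3 : P * zfGain h S i ≤ P * x := by gcongr
      have h4 : 0 ≤ P * L + x / L := by positivity
      linarith
    rw [Real.log_mul (by positivity) (by positivity)] at h2
    have h3 : Real.log (1 + x / L) ≤ x / L := by
      have h4 : 0 < 1 + x / L := by positivity
      have := Real.log_le_sub_one_of_pos h4
      linarith
    -- This is `1 + t ≤ exp t` at `t = a x - L`. The factor `exp (-L) = 1 / K` pays for replacing
    -- one user by the sum over all `K` users, which makes the bound independent of `i` and of the
    -- group.
    have h4 : x / L ≤ 1 / a + 1 / (a * K) * Real.exp (a * x) := by
      have h5 : Real.exp (a * x - L) = Real.exp (a * x) / K := by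
        rw [Real.exp_sub, hLdef, Real.exp_log hK0]
      have h6 : a * x ≤ L + Real.exp (a * x) / K := by
        have := Real.add_one_le_exp (a * x - L)
        rw [h5] at this
        linarith
      have h7 : Real.exp (a * x) / K ≤ L * (Real.exp (a * x) / K) :=
        le_mul_of_one_le_left (by positivity) hL
      rw [div_le_iff₀ (by linarith)]
      have e : (1 / a + 1 / (a * K) * Real.exp (a * x)) * L
          = (L + L * (Real.exp (a * x) / K)) / a := by field_simp
      rw [e, le_div_iff₀ ha]
      linarith
    have h5 : Real.exp (a * x) ≤ ∑ j, Real.exp (a * ‖h j‖ ^ 2) :=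
      Finset.single_le_sum (f := fun j => Real.exp (a * ‖h j‖ ^ 2))
        (fun j _ => (Real.exp_pos _).le) (Finset.mem_univ i)
    have h6 : 1 / (a * K) * Real.exp (a * x) ≤ 1 / (a * K) * ∑ j, Real.exp (a * ‖h j‖ ^ 2) := by
      gcongr
    linarith
  have hlog0 : 0 ≤ Real.log (1 + P * L) := Real.log_nonneg (by linarith)
  refine ⟨fun h => ENNReal.ofReal (r * (Real.log (1 + P * L) + 1 / a))
    + ENNReal.ofReal (r * (1 / (a * K))) * ∑ j, ENNReal.ofReal (Real.exp (a * ‖h j‖ ^ 2)),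
    fun h S hS => ?_, ?_⟩
  · beta_reduce
    rw [← ENNReal.ofReal_sum_of_nonneg fun j _ => (Real.exp_pos _).le,
      ← ENNReal.ofReal_mul (by positivity), ← ENNReal.ofReal_add (by positivity) (by positivity)]
    refine ENNReal.ofReal_le_ofReal ?_
    have hS' : (S.card : ℝ) ≤ r := by exact_mod_cast hS
    calc zfSumRate P h S
        ≤ S.card • (Real.log (1 + P * L) + 1 / a
          + 1 / (a * K) * ∑ j, Real.exp (a * ‖h j‖ ^ 2)) :=
          Finset.sum_le_card_nsmul _ _ _ fun i _ => hrate h i S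
      _ ≤ r * (Real.log (1 + P * L) + 1 / a
          + 1 / (a * K) * ∑ j, Real.exp (a * ‖h j‖ ^ 2)) := by
          rw [nsmul_eq_mul]; gcongr
      _ = _ := by ring
  · have hm : Measurable fun x : ChannelVec r => ENNReal.ofReal (Real.exp (a * ‖x‖ ^ 2)) := by
      fun_prop
    have he : ∀ j : Fin K, ∫⁻ h, ENNReal.ofReal (Real.exp (a * ‖h j‖ ^ 2)) ∂(usersLaw r K)
        = A := fun j =>
      (measurePreserving_eval (fun _ : Fin K => channelLaw r) j).lintegral_comp hm
    have hmj : ∀ j : Fin K, Measurable fun h : Fin K → ChannelVec r =>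
        ENNReal.ofReal (Real.exp (a * ‖h j‖ ^ 2)) := fun j => hm.comp (measurable_pi_apply j)
    rw [lintegral_add_left measurable_const, lintegral_const, measure_univ, mul_one,
      lintegral_const_mul _ (Finset.measurable_sum _ fun j _ => hmj j),
      lintegral_finsetSum _ fun j _ => hmj j]
    simp_rw [he]
    rw [Finset.sum_const, Finset.card_univ, Fintype.card_fin, nsmul_eq_mul,
      ← ENNReal.ofReal_toReal hA.ne, ← ENNReal.ofReal_natCast K,
      ← ENNReal.ofReal_mul hK0.le, ← ENNReal.ofReal_mul (by positivity),
      ← ENNReal.ofReal_add (by positivity) (by positivity)]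
    refine ENNReal.ofReal_le_ofReal ?_
    have h1 : Real.log (1 + P * L) ≤ 2 * Real.log (P * L) := by
      have := Real.log_le_log (x := 1 + P * L) (y := (P * L) ^ 2) (by linarith) (by nlinarith)
      rwa [Real.log_pow, Nat.cast_ofNat] at this
    calc _ = r * (Real.log (1 + P * L) + (1 + A.toReal) / a) := by field_simp; ring
      _ ≤ r * (3 * Real.log (P * L)) := by gcongr; linarith
      _ = _ := by ring

/-! ### Assembling the bounds -/

theorem ofReal_slotRate {r K : ℕ} (P u : ℝ) (h : Fin K → ChannelVec r) :
    ENNReal.ofReal (slotRate P u h) = if (transmitters h u).card ≤ r then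
      ENNReal.ofReal (∑ i ∈ transmitters h u, Real.log (1 + P * zfGain h (transmitters h u) i))
      else 0 := by
  unfold slotRate zfSumRate
  split_ifs <;> simp

/-- Every group of at most `r` out of at least `r` users extends to a group of `r` users. -/
theorem exists_extend_card_eq {r K : ℕ} (hK : r ≤ K) :
    ∃ F : Finset (Fin K) → Finset (Fin K), ∀ S, S.card ≤ r → S ⊆ F S ∧ (F S).card = r := by
  have h : ∀ S : Finset (Fin K), ∃ T, S.card ≤ r → S ⊆ T ∧ T.card = r := fun S => by
    by_cases hS : S.card ≤ r
    · obtain ⟨T, hT⟩ := Finset.exists_superset_card_eq hS (by simpa using hK)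
      exact ⟨T, fun _ => hT⟩
    · exact ⟨S, fun h => absurd h hS⟩
  exact ⟨fun S => (h S).choose, fun S => (h S).choose_spec⟩

theorem sum_log_zfGain_le_zfSumRate {r K : ℕ} {P : ℝ} (hP : 0 ≤ P) (h : Fin K → ChannelVec r)
    {S T : Finset (Fin K)} (hST : S ⊆ T) :
    ∑ i ∈ S, Real.log (1 + P * zfGain h T i) ≤ zfSumRate P h T :=
  Finset.sum_le_sum_of_subset_of_nonneg hST fun _ _ _ =>
    Real.log_nonneg (le_add_of_nonneg_right (mul_nonneg hP (zfGain_nonneg _ _ _)))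

end ZFAccess

open ZFAccess in
theorem mainTheorem1 :
    ∃ c C : ℝ, 0 < c ∧ 0 < C ∧ ∀ r : ℕ, 1 ≤ r → ∃ M : ℝ, ∀ (K : ℕ) (P : ℝ),
      0 < P → M ≤ (K : ℝ) → M ≤ P * Real.log K →
        ZFAccess.optimalExpectedCapacity r K P ∈
          Set.Icc (ENNReal.ofReal (c * (r * Real.log (P * Real.log K))))
            (ENNReal.ofReal (C * (r * Real.log (P * Real.log K)))) ∧
        (∃ u : ℝ, ZFAccess.IsThreshold r K r u) ∧
        (∀ u : ℝ, ZFAccess.IsThreshold r K r u →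
          ZFAccess.expectedCapacity r K P u ∈
            Set.Icc (ENNReal.ofReal (c * (r * Real.log (P * Real.log K))))
              (ENNReal.ofReal (C * (r * Real.log (P * Real.log K))))) ∧
        ZFAccess.centralizedCapacity r K P ∈
          Set.Icc (ENNReal.ofReal (c * (r * Real.log (P * Real.log K))))
            (ENNReal.ofReal (C * (r * Real.log (P * Real.log K)))) := by
  refine ⟨1 / 4800, 3, by norm_num, by norm_num, fun r hr => ?_⟩
  obtain ⟨M₁, hlower⟩ := exists_le_lintegral_sum_log_zfGain hr
  obtain ⟨M₂, hupper⟩ := exists_dominating_rate r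
  refine ⟨max (r + 1) (max M₁ M₂), fun K P hP hK hPL => ?_⟩
  have hrK : r < K := by
    have := (le_max_left _ _).trans hK
    exact_mod_cast (by linarith : (r : ℝ) < K)
  have hK' := (le_max_right _ _).trans hK
  have hPL' := (le_max_right _ _).trans hPL
  have hlow := hlower K P hP ((le_max_left _ _).trans hK') ((le_max_left _ _).trans hPL')
  obtain ⟨Z, hZ, hZint⟩ :=
    hupper K P hP ((le_max_right _ _).trans hK') ((le_max_right _ _).trans hPL')
  obtain ⟨u₀, hu₀⟩ := exists_isThreshold hr hrK
  have halg_le : ∀ u, expectedCapacity r K P u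
      ≤ ENNReal.ofReal (3 * (r * Real.log (P * Real.log K))) := fun u => by
    refine (lintegral_mono fun h => ?_).trans hZint
    rw [slotRate]
    split_ifs with hc
    · exact hZ h _ hc
    · simp
  have hle_alg : ∀ u, IsThreshold r K r u →
      ENNReal.ofReal (1 / 4800 * (r * Real.log (P * Real.log K))) ≤ expectedCapacity r K P u :=
    fun u hu => by
      -- For the algorithm the group is the set of transmitters itself.
      refine (hlow u hu id fun S hS => ⟨subset_rfl, hS⟩).trans_eq ?_
      exact lintegral_congr fun h => (ofReal_slotRate P u h).symm
  refine ⟨⟨?_, ?_⟩, ⟨u₀, hu₀⟩, fun u hu => ⟨hle_alg u hu, halg_le u⟩, ?_, ?_⟩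
  · have hmem : (r : ℝ) ∈ Set.Ioc (0 : ℝ) r := ⟨by exact_mod_cast hr, le_rfl⟩
    exact (hle_alg u₀ hu₀).trans (le_iSup₂_of_le (r : ℝ) hmem (le_iSup₂_of_le u₀ hu₀ le_rfl))
  · exact iSup₂_le fun k _ => iSup₂_le fun u _ => halg_le u
  -- The centralized scheduler may pick the transmitters of the algorithm completed to exactly `r`
  -- users. The gains are then taken within the larger group, which is why the lower bound allows a
  -- general `F`; the added users contribute nonnegative rates.
  · obtain ⟨F, hF⟩ := exists_extend_card_eq hrK.le
    refine (hlow u₀ hu₀ F fun S hS => ⟨(hF S hS).1, (hF S hS).2.le⟩).trans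
      (lintegral_mono fun h => ?_)
    split_ifs with hc
    · exact (ENNReal.ofReal_le_ofReal (sum_log_zfGain_le_zfSumRate hP.le h (hF _ hc).1)).trans
        (le_iSup₂_of_le (F (transmitters h u₀)) (hF _ hc).2 le_rfl)
    · exact zero_le
  · exact (lintegral_mono fun h => iSup₂_le fun S hS => hZ h S hS.le).trans hZint
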